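/- **Setting.** Let $G=(V,E)$ be a finite directed graph and $f\ge 0$ an integer. The nodes of $G$ run a synchronous algorithm: each node $u$ has a binary input, and runs a deterministic state machine whose initial state is determined by its input. In each round every node broadcasts a finite (possibly empty) sequence of messages determined by its current state, receives the messages broadcast by its in-neighbours (knowing the sender of each), and passes to a new state determined by its current state and the messages received. Under *local broadcast*, the messages sent by a node $u$ in a round are received identically and correctly by every $v$ with $(u,v)\in E$. A *Byzantine faulty* node may broadcast arbitrary messages in every round, but it is still subject to local broadcast. A node *outputs* $b\in\{0,1\}$ if after finitely many rounds it decides and its (first) decision is $b$. An algorithm *solves Byzantine consensus on $G$ tolerating at most $f$ faults* if, in every execution with at most $f$ Byzantine faulty nodes and arbitrary inputs, 1. (Agreement) all non-faulty nodes output the same value; 2. (Validity) the output of each non-faulty node is the input of some non-faulty node; 3. (Termination) every non-faulty node decides on its output in finite time. For $A,B\subseteq V$ let $N_A(B)=\{u\in A : \exists v\in B,\ (u,v)\in E\}$. The graph $G$ satisfies *condition NC* (for $f$) if for every $F\subseteq V$ with $|F|\le f$ and every partition $(L,C,R)$ of $V$ into three pairwise disjoint, possibly empty, sets such that $L\setminus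 F$ and $R\setminus F$ are both non-empty, we have $$|N_{R\cup C}(L\setminus F)|>f\qquad\text{or}\qquad |N_{L\cup C}(R\setminus F)|>f .$$ **Theorem.** If there exists an algorithm that solves Byzantine consensus under local broadcast on $G$ tolerating at most $f$ Byzantine faulty nodes, then $G$ satisfies condition NC. -/

import Mathlib

universe u s m

namespace LocalBroadcast

/-- A deterministic synchronous message-passing algorithm on the directed graph `G`: one state
machine for every node. In each round a node broadcasts a finite sequence of messages (possibly
empty) that is determined by its current state, receives the sequences broadcast by its
in-neighbours, each labelled by its sender, and moves to a new state that is determined by the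
current state and by what it received. No computability or finiteness is required. -/
structure Algorithm {V : Type u} (G : Digraph V) : Type (max u (s + 1) (m + 1)) where
  /-- the states of each node -/
  State : V → Type s
  /-- the messages -/
  Msg : Type m
  /-- the initial state of a node, given its binary input -/
  init : (v : V) → Bool → State v
  /-- the messages that a node broadcasts in a round -/
  send : (v : V) → State v → List Msg
  /-- the state transition of a node at the end of a round -/
  step : (v : V) → State v → ({u : V // G.Adj u v} → List Msg) → State v
  /-- the value on which a node has decided, if any -/
  decision : (v : V) → State v → Option Bool

namespace Algorithm

/-- An execution of `A` under local broadcast with faulty set `B` and inputs `x`. The sequence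
`sent t u` that `u` broadcasts in round `t` is the same for all out-neighbours of `u`, and all of
them receive it. Non-faulty nodes follow the algorithm; the broadcasts of the nodes in `B` are
arbitrary. (The states of nodes in `B` are irrelevant.) -/
structure Execution {V : Type*} {G : Digraph V} (A : Algorithm G) (B : Set V) (x : V → Bool) where
  /-- the state of a node at the beginning of a round -/
  state : ℕ → (v : V) → A.State v
  /-- the messages broadcast by a node in a round -/
  sent : ℕ → V → List A.Msg
  state_zero : ∀ v, v ∉ B → state 0 v = A.init v (x v)
  sent_eq : ∀ t v, v ∉ B → sent t v = A.send v (state t v)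
  state_succ : ∀ t v, v ∉ B → state (t + 1) v = A.step v (state t v) fun u => sent t u.1

/-- In the execution `e` the node `v` outputs `b`: after finitely many rounds `v` decides, and its
(first) decision is `b`. -/
def Execution.Outputs {V : Type*} {G : Digraph V} {A : Algorithm G} {B : Set V} {x : V → Bool}
    (e : A.Execution B x) (v : V) (b : Bool) : Prop :=
  ∃ t, A.decision v (e.state t v) = some b ∧ ∀ t' < t, A.decision v (e.state t' v) = none

/-- `A` solves Byzantine consensus under local broadcast, tolerating at most `f` faulty nodes. -/
structure SolvesConsensus {V : Type*} {G : Digraph V} (A : Algorithm G) (f : ℕ) : Prop where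
  agreement : ∀ (B : Set V), B.ncard ≤ f → ∀ (x : V → Bool) (e : A.Execution B x) (u v : V),
    u ∉ B → v ∉ B → ∀ b c : Bool, e.Outputs u b → e.Outputs v c → b = c
  validity : ∀ (B : Set V), B.ncard ≤ f → ∀ (x : V → Bool) (e : A.Execution B x) (v : V),
    v ∉ B → ∀ b : Bool, e.Outputs v b → ∃ w, w ∉ B ∧ x w = b
  termination : ∀ (B : Set V), B.ncard ≤ f → ∀ (x : V → Bool) (e : A.Execution B x) (v : V),
    v ∉ B → ∃ b : Bool, e.Outputs v b

end Algorithm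

/-- The in-neighbourhood of `B` in `A`: the nodes of `A` with an edge to some node of `B`. -/
def inNeighborhood {V : Type*} (G : Digraph V) (A B : Set V) : Set V :=
  {u | u ∈ A ∧ ∃ v ∈ B, G.Adj u v}

/-- `(L, C, R)` is a partition of the node set; parts may be empty. -/
structure IsPartition {V : Type*} (L C R : Set V) : Prop where
  union_eq : L ∪ C ∪ R = Set.univ
  disjoint_L_C : Disjoint L C
  disjoint_L_R : Disjoint L R
  disjoint_C_R : Disjoint C R

/-- Condition NC with parameter `F`, where `f` is the fault bound. -/
def ConditionNCWith {V : Type*} (G : Digraph V) (f : ℕ) (F : Set V) : Prop :=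
  ∀ L C R : Set V, IsPartition L C R → (L \ F).Nonempty → (R \ F).Nonempty →
    f < (inNeighborhood G (R ∪ C) (L \ F)).ncard ∨ f < (inNeighborhood G (L ∪ C) (R \ F)).ncard

/-- Condition NC, where `f` is the fault bound. -/
def ConditionNC {V : Type*} (G : Digraph V) (f : ℕ) : Prop :=
  ∀ F : Set V, F.ncard ≤ f → ConditionNCWith G f F

end LocalBroadcast

namespace LocalBroadcast

namespace Algorithm

variable {V : Type*} {G : Digraph V} (A : Algorithm G)

/-! If NC fails for `F` and `(L, C, R)`, then `F`, `P = N_{R ∪ C}(L \ F)` and `Q = N_{L ∪ C}(R \ F)`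
are all admissible faulty sets. Three executions are coupled: `zero` (inputs false, faulty set `P`),
`one` (inputs true, faulty set `Q`) and `mixed` (false exactly on `L`, faulty set `F`), with the
faulty nodes of each imitating their copies in another. Nodes of `L \ F` cannot tell `mixed` from
`zero`, and nodes of `R \ F` cannot tell it from `one` (`zero_eq_mixed`, `one_eq_mixed`). Validity
in the constant-input runs then makes them output false and true in `mixed`, against agreement. -/

/-- The states of all nodes after a round in which the nodes broadcast `msg`. -/
def advance (state : (v : V) → A.State v) (msg : V → List A.Msg) (v : V) : A.State v :=
  A.step v (state v) fun u => msg u.1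

open Classical in
/-- What the nodes broadcast in the given states if the nodes in `B` broadcast `adv` instead. -/
noncomputable def broadcast (B : Set V) (adv : V → List A.Msg) (state : (v : V) → A.State v)
    (v : V) : List A.Msg :=
  if v ∈ B then adv v else A.send v (state v)

theorem broadcast_of_mem {B : Set V} (adv : V → List A.Msg) (state : (v : V) → A.State v) {v : V}
    (hv : v ∈ B) : A.broadcast B adv state v = adv v := if_pos hv

theorem broadcast_of_notMem {B : Set V} (adv : V → List A.Msg) (state : (v : V) → A.State v)
    {v : V} (hv : v ∉ B) : A.broadcast B adv state v = A.send v (state v) := if_neg hv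

/-- The execution with the given states, inputs and broadcasts of faulty nodes, where faulty nodes
change state as if they were not faulty. -/
noncomputable def Execution.ofStates {A : Algorithm G} (B : Set V) (x : V → Bool)
    (adv : ℕ → V → List A.Msg) (state : ℕ → (v : V) → A.State v)
    (h_zero : ∀ v, state 0 v = A.init v (x v))
    (h_succ : ∀ t, state (t + 1) = A.advance (state t) (A.broadcast B (adv t) (state t))) :
    A.Execution B x where
  state := state
  sent t := A.broadcast B (adv t) (state t)
  state_zero v _ := h_zero v
  sent_eq t _ hv := A.broadcast_of_notMem (adv t) (state t) hv
  state_succ t v _ := congrFun (h_succ t) v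

theorem Execution.Outputs.of_state_eq {A : Algorithm G} {B B' : Set V} {x x' : V → Bool}
    {e : A.Execution B x} {e' : A.Execution B' x'} {v : V} {b : Bool} (h : e.Outputs v b)
    (hs : ∀ t, e.state t v = e'.state t v) : e'.Outputs v b := by
  obtain ⟨t, ht, hlt⟩ := h
  exact ⟨t, hs t ▸ ht, fun t' h' => hs t' ▸ hlt t' h'⟩

/-- If the non-faulty nodes all have input `b`, then every non-faulty node outputs `b`. -/
theorem SolvesConsensus.outputs_const {A : Algorithm G} {f : ℕ} (hA : A.SolvesConsensus f)
    {B : Set V} (hB : B.ncard ≤ f) {b : Bool} (e : A.Execution B fun _ => b) {v : V}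
    (hv : v ∉ B) : e.Outputs v b := by
  obtain ⟨c, hc⟩ := hA.termination B hB _ e v hv
  obtain ⟨_, _, rfl⟩ := hA.validity B hB _ e v hv c hc
  exact hc

/-- Three runs of an algorithm that proceed in parallel. -/
structure Runs where
  /-- the states in the run in which all inputs are `false` -/
  zero : (v : V) → A.State v
  /-- the states in the run in which all inputs are `true` -/
  one : (v : V) → A.State v
  /-- the states in the run with mixed inputs -/
  mixed : (v : V) → A.State v

namespace Runs

variable {A}

open Classical in
/-- The broadcasts in the mixed run: the nodes of `F ∩ L` act as in the first run, the other nodes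
of `F` as in the second run, and the remaining nodes follow the algorithm. -/
noncomputable def mixedSent (F L : Set V) (r : A.Runs) : V → List A.Msg :=
  -- Only current states are consulted, never the other runs' broadcasts, so the mutual imitation is
  -- not circular. For nodes of `F ∩ C` the choice of run is immaterial.
  A.broadcast F (fun v => if v ∈ L then A.send v (r.zero v) else A.send v (r.one v)) r.mixed

/-- One round of the three runs; the nodes of `P` in the first run, and those of `Q` in the second,
act as in the mixed run. -/
noncomputable def next (F L P Q : Set V) (r : A.Runs) : A.Runs where
  zero := A.advance r.zero (A.broadcast P (r.mixedSent F L) r.zero)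
  one := A.advance r.one (A.broadcast Q (r.mixedSent F L) r.one)
  mixed := A.advance r.mixed (r.mixedSent F L)

open Classical in
variable (A) in
/-- The three runs, where in the mixed run the nodes of `L` have input `false` and all others have
input `true`. -/
noncomputable def run (F L P Q : Set V) : ℕ → A.Runs
  | 0 => ⟨fun v => A.init v false, fun v => A.init v true,
      fun v => A.init v (if v ∈ L then false else true)⟩
  | t + 1 => (run F L P Q t).next F L P Q

variable {F L C R : Set V}

/-- Every in-neighbour of a node of `L \ F` sends it the same messages in both runs: inside `L`, it
is honest in `zero`, and in `mixed` it is either imitating `zero` or honest with the same state by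
induction; outside `L`, it is faulty in `zero` and copies `mixed`. -/
theorem zero_eq_mixed (hP : IsPartition L C R) (t : ℕ) :
    let r := run A F L (inNeighborhood G (R ∪ C) (L \ F)) (inNeighborhood G (L ∪ C) (R \ F))
    ∀ v ∈ L \ F, (r t).zero v = (r t).mixed v := by
  intro r
  induction t with
  | zero => intro v hv; simp [r, run, hv.1]
  | succ t ih =>
    intro v hv
    change A.step v _ _ = A.step v _ _
    rw [ih v hv]
    congr 1
    funext ⟨u, hu⟩
    by_cases hL : u ∈ L
    · have hN : u ∉ inNeighborhood G (R ∪ C) (L \ F) := fun h => h.1.elim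
        (Set.disjoint_left.1 hP.disjoint_L_R hL) (Set.disjoint_left.1 hP.disjoint_L_C hL)
      rw [broadcast_of_notMem _ _ _ hN]
      by_cases hF : u ∈ F
      · rw [mixedSent, broadcast_of_mem _ _ _ hF, if_pos hL]
      · rw [mixedSent, broadcast_of_notMem _ _ _ hF, ih u ⟨hL, hF⟩]
    -- A sender outside `L` lies in `R ∪ C`, and its edge to `v` puts it in the faulty set of
    -- `zero`.
    · refine broadcast_of_mem _ _ _ ⟨?_, v, hv, hu⟩
      have := hP.union_eq.symm ▸ Set.mem_univ u
      simp only [Set.mem_union] at this ⊢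
      tauto

theorem one_eq_mixed (hP : IsPartition L C R) (t : ℕ) :
    let r := run A F L (inNeighborhood G (R ∪ C) (L \ F)) (inNeighborhood G (L ∪ C) (R \ F))
    ∀ v ∈ R \ F, (r t).one v = (r t).mixed v := by
  intro r
  induction t with
  | zero => intro v hv; simp [r, run, Set.disjoint_right.1 hP.disjoint_L_R hv.1]
  | succ t ih =>
    intro v hv
    change A.step v _ _ = A.step v _ _
    rw [ih v hv]
    congr 1
    funext ⟨u, hu⟩
    by_cases hR : u ∈ R
    · have hL := Set.disjoint_right.1 hP.disjoint_L_R hR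
      have hN : u ∉ inNeighborhood G (L ∪ C) (R \ F) := fun h => h.1.elim
        hL (Set.disjoint_right.1 hP.disjoint_C_R hR)
      rw [broadcast_of_notMem _ _ _ hN]
      by_cases hF : u ∈ F
      -- A node of `F ∩ R` is outside `L`, so in `mixed` it imitates `one`.
      · rw [mixedSent, broadcast_of_mem _ _ _ hF, if_neg hL]
      · rw [mixedSent, broadcast_of_notMem _ _ _ hF, ih u ⟨hR, hF⟩]
    · refine broadcast_of_mem _ _ _ ⟨?_, v, hv, hu⟩
      have := hP.union_eq.symm ▸ Set.mem_univ u
      simp only [Set.mem_union] at this ⊢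
      tauto

end Runs

open Classical in
/-- An algorithm that solves consensus forces condition NC. -/
theorem SolvesConsensus.conditionNC {A : Algorithm G} {f : ℕ} (hA : A.SolvesConsensus f) :
    ConditionNC G f := by
  intro F hF L C R hP ⟨v, hv⟩ ⟨w, hw⟩
  by_contra! ⟨hL, hR⟩
  let r := Runs.run A F L (inNeighborhood G (R ∪ C) (L \ F)) (inNeighborhood G (L ∪ C) (R \ F))
  let e₀ : A.Execution _ fun _ => false :=
    .ofStates _ _ (fun t => (r t).mixedSent F L) (fun t => (r t).zero) (fun _ => rfl) fun _ => rfl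
  let e₁ : A.Execution _ fun _ => true :=
    .ofStates _ _ (fun t => (r t).mixedSent F L) (fun t => (r t).one) (fun _ => rfl) fun _ => rfl
  let e : A.Execution F fun v => if v ∈ L then false else true :=
    .ofStates _ _ _ (fun t => (r t).mixed) (fun _ => rfl) fun _ => rfl
  -- The failed NC inequality bounds the faulty set, and `v` is honest because that set lies in `R ∪
  -- C`, disjoint from `L`.
  have h₀ : e₀.Outputs v false := hA.outputs_const hL e₀ fun h => h.1.elim
    (Set.disjoint_left.1 hP.disjoint_L_R hv.1) (Set.disjoint_left.1 hP.disjoint_L_C hv.1)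
  have h₁ : e₁.Outputs w true := hA.outputs_const hR e₁ fun h => h.1.elim
    (Set.disjoint_right.1 hP.disjoint_L_R hw.1) (Set.disjoint_right.1 hP.disjoint_C_R hw.1)
  exact Bool.false_ne_true <| hA.agreement F hF _ e v w hv.2 hw.2 _ _
    (h₀.of_state_eq fun t => Runs.zero_eq_mixed hP t v hv)
    (h₁.of_state_eq fun t => Runs.one_eq_mixed hP t w hw)

end Algorithm

end LocalBroadcast

theorem mainTheorem2 {V : Type u} [Finite V] (G : Digraph V) (f : ℕ)
    (h : ∃ A : LocalBroadcast.Algorithm.{u, s, m} G, A.SolvesConsensus f) :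
    LocalBroadcast.ConditionNC G f := by
  obtain ⟨A, hA⟩ := h
  exact hA.conditionNC
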